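/- Let $t_0\le t_f$, let $f:\mathbb R^{n}\times\mathbb R^{m}\times[t_0,t_f]\to\mathbb R^{n}$ and $\ell:\mathbb R^{n}\times\mathbb R^{m}\times[t_0,t_f]\to\mathbb R$ be continuous. For $x,z\in\mathbb R^n$ and $t_0\le s\le\tau\le t_f$ let $$V(x,s;z,\tau)=\inf_{u}\Big\{\int_s^\tau \ell(\xi(t),u(t),t)\,dt \;:\; \dot\xi(t)=f(\xi(t),u(t),t)\text{ on }[s,\tau],\ \xi(s)=x,\ \xi(\tau)=z\Big\}\in[-\infty,\infty]$$ be the conditional value function, where $u:[s,\tau]\to\mathbb R^m$ ranges over the measurable, essentially bounded controls, the differential equation is understood in the Carathéodory sense (that is, $\xi$ is continuous and $\xi(t)=x+\int_s^t f(\xi(r),u(r),r)\,dr$ on $[s,\tau]$; the infimum is over all such pairs $(\xi,u)$), and $\inf\emptyset=+\infty$. Let $t_0\le s<\tau\le t_f$ and $x,z\in\mathbb R^n$ be such that the infimum defining $V(x,s;z,\tau)$ is attained (an optimal control exists) and such that the function $(z',\tau')\mapsto V(x,s;z',\tau')$ on $\mathbb R^n\times[s,t_f]$ is finite near $(z,\tau)$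 and differentiable at $(z,\tau)$. Then $V$ satisfies the forward conditional Hamilton--Jacobi--Bellman equation in its upper time limit at $(z,\tau)$: $$\frac{\partial V(x,s;z,\tau)}{\partial\tau}=\min_{u\in\mathbb R^m}\Big\{\ell(z,u,\tau)-\Big(\frac{\partial V(x,s;z,\tau)}{\partial z}\Big)^{\!\top} f(z,u,\tau)\Big\},$$ and in particular the minimum on the right-hand side is attained. (For $\tau=t_f$ the $\tau$-derivative is one-sided.) -/

import Mathlib

open MeasureTheory Set Filter Topology
open scoped ENNReal

/-- `(ξ, u)` is an admissible trajectory/control pair on `[s, τ]` for the dynamics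
`dξ/dt = f(ξ, u, t)` steering the state from `ξ(s) = x` to `ξ(τ) = z`.

Controls are measurable and essentially bounded, and the differential equation is understood in
the usual (Carathéodory) sense, that is, in its integral form. For continuous `f` the integrand is
bounded and measurable on `[s, τ]`, hence integrable. -/
structure IsAdmissible {n m : ℕ}
    (f : EuclideanSpace ℝ (Fin n) → EuclideanSpace ℝ (Fin m) → ℝ → EuclideanSpace ℝ (Fin n))
    (x : EuclideanSpace ℝ (Fin n)) (s : ℝ) (z : EuclideanSpace ℝ (Fin n)) (τ : ℝ)
    (ξ : ℝ → EuclideanSpace ℝ (Fin n)) (u : ℝ → EuclideanSpace ℝ (Fin m)) : Prop where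
  le : s ≤ τ
  memLp : MemLp u ∞ (volume.restrict (Icc s τ))
  continuousOn : ContinuousOn ξ (Icc s τ)
  dynamics : ∀ t ∈ Icc s τ, ξ t = ξ s + ∫ r in s..t, f (ξ r) (u r) r
  start : ξ s = x
  finish : ξ τ = z

/-- The cost `∫_s^τ ℓ(ξ(t), u(t), t) dt`. -/
noncomputable def runningCost {n m : ℕ}
    (ℓ : EuclideanSpace ℝ (Fin n) → EuclideanSpace ℝ (Fin m) → ℝ → ℝ) (s τ : ℝ)
    (ξ : ℝ → EuclideanSpace ℝ (Fin n)) (u : ℝ → EuclideanSpace ℝ (Fin m)) : ℝ :=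
  ∫ t in s..τ, ℓ (ξ t) (u t) t

/-- The conditional value function `V(x, s; z, τ)`: the least cost over all admissible pairs that
steer `x` at time `s` to `z` at time `τ`. It is `⊤` when `z` cannot be reached. -/
noncomputable def condValue {n m : ℕ}
    (f : EuclideanSpace ℝ (Fin n) → EuclideanSpace ℝ (Fin m) → ℝ → EuclideanSpace ℝ (Fin n))
    (ℓ : EuclideanSpace ℝ (Fin n) → EuclideanSpace ℝ (Fin m) → ℝ → ℝ)
    (x : EuclideanSpace ℝ (Fin n)) (s : ℝ) (z : EuclideanSpace ℝ (Fin n)) (τ : ℝ) : EReal :=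
  ⨅ (ξ : ℝ → EuclideanSpace ℝ (Fin n)) (u : ℝ → EuclideanSpace ℝ (Fin m))
    (_ : IsAdmissible f x s z τ ξ u), ((runningCost ℓ s τ ξ u : ℝ) : EReal)

/-- `(ξ, u)` is an optimal pair for the conditional problem: the minimum is attained there. -/
def IsOptimal {n m : ℕ}
    (f : EuclideanSpace ℝ (Fin n) → EuclideanSpace ℝ (Fin m) → ℝ → EuclideanSpace ℝ (Fin n))
    (ℓ : EuclideanSpace ℝ (Fin n) → EuclideanSpace ℝ (Fin m) → ℝ → ℝ)
    (x : EuclideanSpace ℝ (Fin n)) (s : ℝ) (z : EuclideanSpace ℝ (Fin n)) (τ : ℝ)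
    (ξ : ℝ → EuclideanSpace ℝ (Fin n)) (u : ℝ → EuclideanSpace ℝ (Fin m)) : Prop :=
  IsAdmissible f x s z τ ξ u ∧ ((runningCost ℓ s τ ξ u : ℝ) : EReal) = condValue f ℓ x s z τ

/-!
Write `V(z, τ)` for the conditional value function with `x` and `s` fixed and `L` for its derivative
at `(z, τ)`, so that `L(w, h) = ∇V · w + h ∂V/∂τ`. The equation says that
`ℓ(z, w, τ) - L(f(z, w, τ), 1)` is nonnegative for every control value `w` and vanishes for some `w`.
Both halves look backward from `τ`, so the final time `τ = t_f` needs no separate treatment.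

*Nonnegativity* (`fderiv_condValue_apply_le`). As `f` is only continuous, Peano's theorem
(`exists_backward_solution`, obtained from delayed equations and the Arzelà–Ascoli theorem) is what
provides a trajectory `η` of the constant control `w` with `η(τ) = z`. By dynamic programming
(`condValue_toReal_le_add`), `V(z, τ) ≤ V(η(t), t) + ∫ ℓ` over `[t, τ]` for `t` close to `τ`, that is,
`t ↦ V(η(t), t) + ∫ ℓ` has a one-sided minimum at `t = τ`; the sign of its derivative is the claim.

*Attainment* (`exists_le_fderiv_condValue_apply`). Along an optimal pair `(ξ, u)` the dynamic
programming inequality is reversed: `V(ξ(t), t) + ∫ ℓ ≤ V(z, τ)`. The control `u` need not have a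
limit at `τ`, but it stays in a compact ball. There the continuous function
`w ↦ ℓ(z, w, τ) - L(f(z, w, τ), 1)` has a minimizer, and the integrand `ℓ - L(f, 1)` along `(ξ, u)` is
bounded below by this minimum up to a small error. As `ξ` is Lipschitz, the
expansion of `V` at `(z, τ)` shows that the mean of the integrand over `[t, τ]` is at most `o(1)`, so
the minimum is not positive.
-/

/-! ### Peano's existence theorem -/

section Peano

variable {E : Type*} [NormedAddCommGroup E] [NormedSpace ℝ E]

/-- One Picard step, with delay `d`, for the equation `X' = g(t, X)`, `X(0) = z`. For `t ≤ 0` the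
result is constantly `z`, which supplies the history that the delay refers to. -/
noncomputable def delayedPicard (g : ℝ → E → E) (z : E) (d : ℝ) (X : ℝ → E) (t : ℝ) : E :=
  z + ∫ r in (0 : ℝ)..max t 0, g r (X (r - d))

theorem lipschitzWith_delayedPicard {g : ℝ → E → E} (hg : Continuous fun q : ℝ × E => g q.1 q.2)
    {M : NNReal} (hM : ∀ t y, ‖g t y‖ ≤ M) (z : E) (d : ℝ) {X : ℝ → E} (hX : Continuous X) :
    LipschitzWith M (delayedPicard g z d X) := by
  have hc : Continuous fun r => g r (X (r - d)) :=
    hg.comp (continuous_id.prodMk (hX.comp (continuous_id.sub continuous_const)))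
  refine LipschitzWith.of_dist_le_mul fun a b => ?_
  have hsub : delayedPicard g z d X a - delayedPicard g z d X b =
      ∫ r in (max b 0)..max a 0, g r (X (r - d)) := by
    rw [delayedPicard, delayedPicard, add_sub_add_left_eq_sub,
      intervalIntegral.integral_interval_sub_left (hc.intervalIntegrable _ _)
        (hc.intervalIntegrable _ _)]
  rw [dist_eq_norm, hsub, Real.dist_eq]
  refine (intervalIntegral.norm_integral_le_of_norm_le_const fun r _ => hM _ _).trans ?_
  exact mul_le_mul_of_nonneg_left (abs_max_sub_max_le_abs a b 0) M.2

/-- The iterates of the delayed Picard step stabilise: the `k`-th one is already a fixed point up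
to time `k * d`. -/
theorem delayedPicard_iterate_eq (g : ℝ → E → E) (z : E) {d : ℝ} (k : ℕ) {t : ℝ}
    (ht : t ≤ k * d) :
    delayedPicard g z d ((delayedPicard g z d)^[k] fun _ => z) t =
      (delayedPicard g z d)^[k] (fun _ => z) t := by
  induction k generalizing t with
  | zero =>
    have : t ≤ 0 := by simpa using ht
    simp [delayedPicard, max_eq_right this]
  | succ k ih =>
    rw [Function.iterate_succ_apply']
    rcases le_total t 0 with h0 | h0
    · simp [delayedPicard, max_eq_right h0]
    rw [delayedPicard, delayedPicard, max_eq_left h0]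
    congr 1
    refine intervalIntegral.integral_congr fun r hr => ?_
    rw [uIcc_of_le h0] at hr
    have : r - d ≤ k * d := by
      push_cast at ht
      linarith [hr.2]
    exact congrArg (g r) (ih this)

/-- Tonelli's approximate solutions: the equation with a positive delay is solvable on `[0, T]`. -/
theorem exists_delayed_solution {g : ℝ → E → E} (hg : Continuous fun q : ℝ × E => g q.1 q.2)
    {M : NNReal} (hM : ∀ t y, ‖g t y‖ ≤ M) (z : E) {d : ℝ} (hd : 0 < d) (T : ℝ) :
    ∃ X : ℝ → E, LipschitzWith M X ∧ ∀ t ∈ Icc 0 T,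
      X t = z + ∫ r in (0 : ℝ)..t, g r (X (r - d)) := by
  obtain ⟨N, hN⟩ := exists_nat_ge (T / d)
  refine ⟨(delayedPicard g z d)^[N] fun _ => z, ?_, fun t ht => ?_⟩
  · clear hN
    induction N with
    | zero => exact LipschitzWith.const' z |>.weaken zero_le
    | succ k ih =>
      rw [Function.iterate_succ_apply']
      exact lipschitzWith_delayedPicard hg hM z d ih.continuous
  · have hle : t ≤ N * d := ht.2.trans ((div_le_iff₀ hd).1 hN)
    conv_lhs => rw [← delayedPicard_iterate_eq g z N hle, delayedPicard, max_eq_left ht.1]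

variable [FiniteDimensional ℝ E]

/-- Uniformly Lipschitz functions with a common initial value have, on `[0, T]`, a pointwise
convergent subsequence with a continuous limit. -/
theorem exists_subseq_tendsto_of_lipschitzWith {M : NNReal} {z : E} {T : ℝ} (hT : 0 ≤ T)
    {X : ℕ → ℝ → E} (hX : ∀ k, LipschitzWith M (X k)) (h0 : ∀ k, X k 0 = z) :
    ∃ Y : ℝ → E, Continuous Y ∧ ∃ φ : ℕ → ℕ, StrictMono φ ∧
      ∀ t ∈ Icc 0 T, Tendsto (fun k => X (φ k) t) atTop (𝓝 (Y t)) := by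
  have := FiniteDimensional.proper ℝ E
  let R (k : ℕ) : BoundedContinuousFunction (Icc 0 T) E :=
    BoundedContinuousFunction.mkOfCompact
      ⟨fun t => X k t, (hX k).continuous.comp continuous_subtype_val⟩
  have hcomp : IsCompact (closure (range R)) := by
    refine BoundedContinuousFunction.arzela_ascoli (Metric.closedBall z (M * T))
      (isCompact_closedBall _ _) _ ?_ ?_
    · rintro _ t ⟨k, rfl⟩
      have h := (hX k).dist_le_mul t 0
      rw [h0 k, Real.dist_eq, sub_zero, abs_of_nonneg t.2.1] at h
      exact h.trans (mul_le_mul_of_nonneg_left t.2.2 M.2)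
    · refine (LipschitzWith.uniformEquicontinuous _ M ?_).equicontinuous
      rintro ⟨_, k, rfl⟩
      exact ((hX k).comp (LipschitzWith.subtype_val _)).weaken (mul_one M).le
  obtain ⟨G, -, φ, hφ, hG⟩ :=
    hcomp.tendsto_subseq fun k => subset_closure (mem_range_self (f := R) k)
  refine ⟨fun t => G (projIcc 0 T hT t), G.continuous.comp continuous_projIcc, φ, hφ,
    fun t ht => ?_⟩
  have : Tendsto (fun k => X (φ k) t) atTop (𝓝 (G ⟨t, ht⟩)) := 
    ((continuous_eval_const (⟨t, ht⟩ : Icc (0 : ℝ) T)).tendsto G).comp hG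
  simpa only [projIcc_of_mem hT ht] using this

/-- **Peano's existence theorem** for a bounded continuous right-hand side, in integral form. -/
theorem exists_solution_of_bounded {g : ℝ → E → E} (hg : Continuous fun q : ℝ × E => g q.1 q.2)
    {M : NNReal} (hM : ∀ t y, ‖g t y‖ ≤ M) (z : E) {T : ℝ} (hT : 0 ≤ T) :
    ∃ X : ℝ → E, Continuous X ∧ ∀ t ∈ Icc 0 T, X t = z + ∫ r in (0 : ℝ)..t, g r (X r) := by
  have hpos (k : ℕ) : (0 : ℝ) < 1 / ((k : ℝ) + 1) := Nat.one_div_pos_of_nat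
  choose X hLip hsol using fun k : ℕ => exists_delayed_solution hg hM z (hpos k) T
  have h0 (k : ℕ) : X k 0 = z := by simpa using hsol k 0 (left_mem_Icc.2 hT)
  obtain ⟨Y, hY, φ, hφ, hlim⟩ := exists_subseq_tendsto_of_lipschitzWith hT hLip h0
  refine ⟨Y, hY, fun t ht => tendsto_nhds_unique (hlim t ht) ?_⟩
  simp_rw [fun k => hsol (φ k) t ht]
  refine tendsto_const_nhds.add
    (intervalIntegral.tendsto_integral_filter_of_dominated_convergence (fun _ => (M : ℝ))
      (.of_forall fun k => ?_) (.of_forall fun k => .of_forall fun r _ => hM _ _)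
      intervalIntegrable_const (.of_forall fun r hr => ?_))
  · exact (hg.comp (continuous_id.prodMk ((hLip (φ k)).continuous.comp
      (continuous_id.sub continuous_const)))).aestronglyMeasurable
  · rw [uIoc_of_le ht.1] at hr
    -- the common Lipschitz constant makes the delay harmless in the limit
    have hshift : Tendsto (fun k => X (φ k) (r - 1 / ((φ k : ℝ) + 1))) atTop (𝓝 (Y r)) := by
      refine (tendsto_iff_of_dist ?_).1 (hlim r ⟨hr.1.le, hr.2.trans ht.2⟩)
      have hd : Tendsto (fun k => (M : ℝ) * (1 / ((φ k : ℝ) + 1))) atTop (𝓝 0) := by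
        simpa using (tendsto_one_div_add_atTop_nhds_zero_nat.comp hφ.tendsto_atTop).const_mul (M : ℝ)
      refine squeeze_zero (fun _ => dist_nonneg) (fun k => ?_) hd
      refine ((hLip (φ k)).dist_le_mul _ _).trans_eq ?_
      rw [Real.dist_eq, sub_sub_cancel, abs_of_pos (hpos _)]
    exact (hg.tendsto (r, Y r)).comp (tendsto_const_nhds.prodMk_nhds hshift)

/-- Peano's theorem, local and backward in time: a continuous vector field has an integral curve
that ends at a prescribed point `z` at a prescribed time `τ`. -/
theorem exists_backward_solution {F : E → ℝ → E} (hF : Continuous fun q : E × ℝ => F q.1 q.2)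
    (z : E) (τ : ℝ) :
    ∃ η : ℝ → E, Continuous η ∧ η τ = z ∧
      ∃ a < τ, ∀ t ∈ Ioc a τ, η t = z - ∫ r in t..τ, F (η r) r := by
  -- Rescaling the values of `F` to norm at most `M` changes nothing near `(z, τ)`.
  set M : NNReal := ‖F z τ‖₊ + 1 with hMdef
  have hM0 : (0 : ℝ) < M := by positivity
  let g (t : ℝ) (y : E) : E := ((M : ℝ) / max (M : ℝ) ‖F y (τ - t)‖) • -F y (τ - t)
  have hFc : Continuous fun q : ℝ × E => F q.2 (τ - q.1) :=
    hF.comp (continuous_snd.prodMk (continuous_const.sub continuous_fst))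
  have hg : Continuous fun q : ℝ × E => g q.1 q.2 :=
    (continuous_const.div (continuous_const.max hFc.norm)
      fun q => (lt_max_of_lt_left hM0).ne').smul hFc.neg
  have hgM (t : ℝ) (y : E) : ‖g t y‖ ≤ M := by
    have hpos : 0 < max (M : ℝ) ‖F y (τ - t)‖ := lt_max_of_lt_left hM0
    simp only [g]
    rw [norm_smul, norm_neg, Real.norm_of_nonneg (by positivity), div_mul_eq_mul_div,
      div_le_iff₀ hpos]
    exact mul_le_mul_of_nonneg_left (le_max_right _ _) hM0.le
  obtain ⟨X, hX, hsol⟩ := exists_solution_of_bounded hg hgM z zero_le_one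
  have hX0 : X 0 = z := by simpa using hsol 0 (by simp)
  have hη : Continuous fun t => X (τ - t) := hX.comp (continuous_const.sub continuous_id)
  have hnear : ∀ᶠ t in 𝓝 τ, ‖F (X (τ - t)) t‖ < M := by
    have hc : Continuous fun t => ‖F (X (τ - t)) t‖ := (hF.comp (hη.prodMk continuous_id)).norm
    refine hc.continuousAt.eventually_lt_const ?_
    simp [hX0, hMdef]
  obtain ⟨δ, hδ, hball⟩ := Metric.eventually_nhds_iff.1 hnear
  refine ⟨fun t => X (τ - t), hη, by simpa using hX0, τ - min δ 1,
    sub_lt_self _ (lt_min hδ one_pos), fun t ⟨ht1, ht2⟩ => ?_⟩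
  have hδt := min_le_left δ 1
  have h1t := min_le_right δ 1
  have hs := hsol (τ - t) ⟨by linarith, by linarith⟩
  beta_reduce
  rw [hs, sub_eq_add_neg z, ← intervalIntegral.integral_neg]
  congr 1
  have hsub := intervalIntegral.integral_comp_sub_left (a := t) (b := τ)
    (fun r => g r (X r)) τ
  rw [sub_self] at hsub
  rw [← hsub]
  refine intervalIntegral.integral_congr fun r hr => ?_
  rw [uIcc_of_le ht2] at hr
  have hle : ‖F (X (τ - r)) r‖ ≤ M := by
    refine (hball ?_).le
    rw [Real.dist_eq, abs_lt]
    constructor <;> linarith [hr.1, hr.2]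
  simp only [g, sub_sub_cancel]
  rw [max_eq_left hle, div_self hM0.ne', one_smul]

end Peano

/-! ### Admissible pairs and dynamic programming -/

section Admissible

variable {n m : ℕ}
  {f : EuclideanSpace ℝ (Fin n) → EuclideanSpace ℝ (Fin m) → ℝ → EuclideanSpace ℝ (Fin n)}
  {ℓ : EuclideanSpace ℝ (Fin n) → EuclideanSpace ℝ (Fin m) → ℝ → ℝ}
  {x y z : EuclideanSpace ℝ (Fin n)} {s r τ : ℝ}
  {ξ ξ₁ ξ₂ : ℝ → EuclideanSpace ℝ (Fin n)} {u u₁ u₂ : ℝ → EuclideanSpace ℝ (Fin m)}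

theorem IsAdmissible.exists_control_bound (h : IsAdmissible f x s z τ ξ u) :
    ∃ R : ℝ, 0 ≤ R ∧ ∀ᵐ t ∂volume.restrict (Icc s τ), ‖u t‖ ≤ R :=
  ⟨_, lpNorm_nonneg, ae_le_lpNorm_exponent_top h.memLp⟩

/-- A continuous function is essentially bounded along an admissible pair. -/
theorem IsAdmissible.exists_bound {G : Type*} [NormedAddCommGroup G]
    (h : IsAdmissible f x s z τ ξ u)
    {g : EuclideanSpace ℝ (Fin n) → EuclideanSpace ℝ (Fin m) → ℝ → G}
    (hg : Continuous fun q : EuclideanSpace ℝ (Fin n) × EuclideanSpace ℝ (Fin m) × ℝ =>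
      g q.1 q.2.1 q.2.2) :
    ∃ C, ∀ᵐ t ∂volume.restrict (Icc s τ), ‖g (ξ t) (u t) t‖ ≤ C := by
  obtain ⟨R, -, hR⟩ := h.exists_control_bound
  obtain ⟨C, hC⟩ := ((isCompact_Icc.image_of_continuousOn h.continuousOn).prod
    ((isCompact_closedBall (0 : EuclideanSpace ℝ (Fin m)) R).prod
      (isCompact_Icc (a := s) (b := τ)))).exists_bound_of_continuousOn hg.continuousOn
  refine ⟨C, ?_⟩
  filter_upwards [hR, ae_restrict_mem measurableSet_Icc] with t ht htI
  exact hC (ξ t, u t, t) ⟨mem_image_of_mem _ htI, mem_closedBall_zero_iff.2 ht, htI⟩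

theorem IsAdmissible.intervalIntegrable {G : Type*} [NormedAddCommGroup G]
    (h : IsAdmissible f x s z τ ξ u)
    {g : EuclideanSpace ℝ (Fin n) → EuclideanSpace ℝ (Fin m) → ℝ → G}
    (hg : Continuous fun q : EuclideanSpace ℝ (Fin n) × EuclideanSpace ℝ (Fin m) × ℝ =>
      g q.1 q.2.1 q.2.2) {a b : ℝ} (ha : a ∈ Icc s τ) (hb : b ∈ Icc s τ) :
    IntervalIntegrable (fun t => g (ξ t) (u t) t) volume a b := by
  obtain ⟨C, hC⟩ := h.exists_bound hg
  have hmeas : AEStronglyMeasurable (fun t => g (ξ t) (u t) t) (volume.restrict (Icc s τ)) :=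
    hg.comp_aestronglyMeasurable ((h.continuousOn.aestronglyMeasurable measurableSet_Icc).prodMk
      (h.memLp.1.prodMk aestronglyMeasurable_id))
  have hint : IntegrableOn (fun t => g (ξ t) (u t) t) (Icc s τ) := Integrable.of_bound hmeas C hC
  exact (hint.mono_set (uIcc_subset_Icc ha hb)).intervalIntegrable

theorem IsAdmissible.sub_eq_integral (h : IsAdmissible f x s z τ ξ u)
    (hf : Continuous fun q : EuclideanSpace ℝ (Fin n) × EuclideanSpace ℝ (Fin m) × ℝ =>
      f q.1 q.2.1 q.2.2) {a b : ℝ} (ha : a ∈ Icc s τ) (hb : b ∈ Icc s τ) :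
    ξ b - ξ a = ∫ t in a..b, f (ξ t) (u t) t := by
  have hs : s ∈ Icc s τ := left_mem_Icc.2 h.le
  rw [h.dynamics b hb, h.dynamics a ha, add_sub_add_left_eq_sub,
    intervalIntegral.integral_interval_sub_left (h.intervalIntegrable hf hs hb)
      (h.intervalIntegrable hf hs ha)]

theorem IsAdmissible.restrict (h : IsAdmissible f x s z τ ξ u) (hr : r ∈ Icc s τ) :
    IsAdmissible f x s (ξ r) r ξ u where
  le := hr.1
  memLp := h.memLp.mono_measure (Measure.restrict_mono (Icc_subset_Icc_right hr.2) le_rfl)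
  continuousOn := h.continuousOn.mono (Icc_subset_Icc_right hr.2)
  dynamics t ht := h.dynamics t (Icc_subset_Icc_right hr.2 ht)
  start := h.start
  finish := rfl

/-- Integrals along two pairs glued at time `r`, up to a time before the junction. -/
theorem integral_glue_left {G : Type*} [NormedAddCommGroup G] [NormedSpace ℝ G]
    (g : EuclideanSpace ℝ (Fin n) → EuclideanSpace ℝ (Fin m) → ℝ → G) {t : ℝ}
    (hst : s ≤ t) (htr : t ≤ r) :
    ∫ q in s..t, g (if q ≤ r then ξ₁ q else ξ₂ q) (if q ≤ r then u₁ q else u₂ q) q =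
      ∫ q in s..t, g (ξ₁ q) (u₁ q) q := by
  refine intervalIntegral.integral_congr fun q hq => ?_
  rw [uIcc_of_le hst] at hq
  simp only [if_pos (hq.2.trans htr)]

/-- Integrals along two pairs glued at time `r`, up to a time after the junction. -/
theorem IsAdmissible.integral_glue {G : Type*} [NormedAddCommGroup G] [NormedSpace ℝ G]
    (h₁ : IsAdmissible f x s y r ξ₁ u₁) (h₂ : IsAdmissible f y r z τ ξ₂ u₂)
    {g : EuclideanSpace ℝ (Fin n) → EuclideanSpace ℝ (Fin m) → ℝ → G}
    (hg : Continuous fun q : EuclideanSpace ℝ (Fin n) × EuclideanSpace ℝ (Fin m) × ℝ =>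
      g q.1 q.2.1 q.2.2) {t : ℝ} (ht : t ∈ Icc r τ) :
    ∫ q in s..t, g (if q ≤ r then ξ₁ q else ξ₂ q) (if q ≤ r then u₁ q else u₂ q) q =
      (∫ q in s..r, g (ξ₁ q) (u₁ q) q) + ∫ q in r..t, g (ξ₂ q) (u₂ q) q := by
  have hI₁ := h₁.intervalIntegrable hg (left_mem_Icc.2 h₁.le) (right_mem_Icc.2 h₁.le)
  have hI₂ := h₂.intervalIntegrable hg (left_mem_Icc.2 h₂.le) ht
  have hright : EqOn (fun q => g (ξ₂ q) (u₂ q) q)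
      (fun q => g (if q ≤ r then ξ₁ q else ξ₂ q) (if q ≤ r then u₁ q else u₂ q) q)
      (uIoc r t) := fun q hq => by
    rw [uIoc_of_le ht.1] at hq
    simp only [if_neg hq.1.not_ge]
  rw [← integral_glue_left (ξ₁ := ξ₁) (ξ₂ := ξ₂) (u₁ := u₁) (u₂ := u₂) g h₁.le le_rfl,
    intervalIntegral.integral_congr_ae (.of_forall hright)]
  refine (intervalIntegral.integral_add_adjacent_intervals (hI₁.congr fun q hq => ?_)
    (hI₂.congr hright)).symm
  rw [uIoc_of_le h₁.le] at hq
  simp only [if_pos hq.2]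

theorem IsAdmissible.glue
    (hf : Continuous fun q : EuclideanSpace ℝ (Fin n) × EuclideanSpace ℝ (Fin m) × ℝ =>
      f q.1 q.2.1 q.2.2)
    (h₁ : IsAdmissible f x s y r ξ₁ u₁) (h₂ : IsAdmissible f y r z τ ξ₂ u₂) :
    IsAdmissible f x s z τ (fun t => if t ≤ r then ξ₁ t else ξ₂ t)
      (fun t => if t ≤ r then u₁ t else u₂ t) where
  le := h₁.le.trans h₂.le
  memLp := by
    classical
    have hsubl : Iic r ∩ Icc s τ ⊆ Icc s r := fun t ht => ⟨ht.2.1, ht.1⟩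
    have hsubr : (Iic r)ᶜ ∩ Icc s τ ⊆ Icc r τ := fun t ht => ⟨(notMem_Iic.1 ht.1).le, ht.2.2⟩
    have hleft : MemLp u₁ ∞ ((volume.restrict (Icc s τ)).restrict (Iic r)) := by
      rw [Measure.restrict_restrict measurableSet_Iic]
      exact h₁.memLp.mono_measure (Measure.restrict_mono hsubl le_rfl)
    have hright : MemLp u₂ ∞ ((volume.restrict (Icc s τ)).restrict (Iic r)ᶜ) := by
      rw [Measure.restrict_restrict measurableSet_Iic.compl]
      exact h₂.memLp.mono_measure (Measure.restrict_mono hsubr le_rfl)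
    exact MemLp.piecewise measurableSet_Iic hleft hright
  continuousOn := by
    have hy : ξ₁ r = ξ₂ r := h₁.finish.trans h₂.start.symm
    rw [← Icc_union_Icc_eq_Icc h₁.le h₂.le]
    refine ContinuousOn.union_of_isClosed ?_ ?_ isClosed_Icc isClosed_Icc
    · exact h₁.continuousOn.congr fun t ht => if_pos ht.2
    · refine h₂.continuousOn.congr fun t ht => ?_
      rcases ht.1.eq_or_lt with rfl | hlt
      · simpa using hy
      · exact if_neg hlt.not_ge
  dynamics t ht := by
    simp only [if_pos h₁.le]
    rcases le_total t r with htr | hrt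
    · rw [integral_glue_left f ht.1 htr, if_pos htr]
      exact h₁.dynamics t ⟨ht.1, htr⟩
    · rw [h₁.integral_glue h₂ hf ⟨hrt, ht.2⟩, ← add_assoc, ← h₁.dynamics r (right_mem_Icc.2 h₁.le), h₁.finish]
      rcases hrt.eq_or_lt with rfl | hlt
      · simpa using h₁.finish
      · rw [if_neg hlt.not_ge, ← h₂.start]
        exact h₂.dynamics t ⟨hrt, ht.2⟩
  start := by simpa only [if_pos h₁.le] using h₁.start
  finish := by
    rcases h₂.le.eq_or_lt with rfl | hlt
    · simpa using h₁.finish.trans (h₂.start.symm.trans h₂.finish)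
    · simpa only [if_neg hlt.not_ge] using h₂.finish

theorem IsAdmissible.condValue_le (h : IsAdmissible f x s z τ ξ u) :
    condValue f ℓ x s z τ ≤ (runningCost ℓ s τ ξ u : ℝ) :=
  iInf_le_of_le ξ (iInf_le_of_le u (iInf_le _ h))

/-- The dynamic programming inequality: continuing an arbitrary pair that ends in `y` at time `r`
by a fixed pair from `y` to `z` bounds the value at `z`. -/
theorem condValue_toReal_le_add
    (hf : Continuous fun q : EuclideanSpace ℝ (Fin n) × EuclideanSpace ℝ (Fin m) × ℝ =>
      f q.1 q.2.1 q.2.2)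
    (hℓ : Continuous fun q : EuclideanSpace ℝ (Fin n) × EuclideanSpace ℝ (Fin m) × ℝ =>
      ℓ q.1 q.2.1 q.2.2)
    (hbot : condValue f ℓ x s z τ ≠ ⊥) (htop : condValue f ℓ x s y r ≠ ⊤)
    (h : IsAdmissible f y r z τ ξ u) :
    (condValue f ℓ x s z τ).toReal ≤ (condValue f ℓ x s y r).toReal + runningCost ℓ r τ ξ u := by
  have hle (ξ₁ u₁) (h₁ : IsAdmissible f x s y r ξ₁ u₁) :
      condValue f ℓ x s z τ ≤ ((runningCost ℓ s r ξ₁ u₁ + runningCost ℓ r τ ξ u : ℝ) : EReal) := by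
    refine (h₁.glue hf h).condValue_le.trans_eq ?_
    rw [EReal.coe_eq_coe_iff]
    exact h₁.integral_glue h hℓ (right_mem_Icc.2 h.le)
  have hzt : condValue f ℓ x s z τ ≠ ⊤ := by
    intro htop'
    refine htop (le_antisymm le_top ?_)
    refine le_iInf fun ξ₁ => le_iInf fun u₁ => le_iInf fun h₁ => ?_
    exact absurd htop' ((hle ξ₁ u₁ h₁).trans_lt (EReal.coe_lt_top _)).ne
  have hmain : (((condValue f ℓ x s z τ).toReal - runningCost ℓ r τ ξ u : ℝ) : EReal) ≤
      condValue f ℓ x s y r := by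
    refine le_iInf fun ξ₁ => le_iInf fun u₁ => le_iInf fun h₁ => ?_
    have := hle ξ₁ u₁ h₁
    rw [← EReal.coe_toReal hzt hbot, EReal.coe_le_coe_iff] at this
    rw [EReal.coe_le_coe_iff]
    linarith
  have hyb : condValue f ℓ x s y r ≠ ⊥ := ((EReal.bot_lt_coe _).trans_le hmain).ne'
  rw [← EReal.coe_toReal htop hyb, EReal.coe_le_coe_iff] at hmain
  linarith

theorem IsAdmissible.congr_dynamics
    {f' : EuclideanSpace ℝ (Fin n) → EuclideanSpace ℝ (Fin m) → ℝ → EuclideanSpace ℝ (Fin n)}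
    (hff' : ∀ y v, ∀ t ∈ Icc s τ, f y v t = f' y v t) (h : IsAdmissible f x s z τ ξ u) :
    IsAdmissible f' x s z τ ξ u where
  le := h.le
  memLp := h.memLp
  continuousOn := h.continuousOn
  dynamics t ht := by
    rw [h.dynamics t ht]
    congr 1
    refine intervalIntegral.integral_congr fun q hq => ?_
    rw [uIcc_of_le ht.1] at hq
    exact hff' _ _ q ⟨hq.1, hq.2.trans ht.2⟩
  start := h.start
  finish := h.finish

theorem runningCost_congr
    {ℓ' : EuclideanSpace ℝ (Fin n) → EuclideanSpace ℝ (Fin m) → ℝ → ℝ} (hsτ : s ≤ τ)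
    (hℓℓ' : ∀ y v, ∀ t ∈ Icc s τ, ℓ y v t = ℓ' y v t) :
    runningCost ℓ s τ ξ u = runningCost ℓ' s τ ξ u := by
  refine intervalIntegral.integral_congr fun q hq => ?_
  rw [uIcc_of_le hsτ] at hq
  exact hℓℓ' _ _ q hq

/-- The value function depends only on the data between the two times. -/
theorem condValue_congr
    {f' : EuclideanSpace ℝ (Fin n) → EuclideanSpace ℝ (Fin m) → ℝ → EuclideanSpace ℝ (Fin n)}
    {ℓ' : EuclideanSpace ℝ (Fin n) → EuclideanSpace ℝ (Fin m) → ℝ → ℝ} (hsτ : s ≤ τ)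
    (hff' : ∀ y v, ∀ t ∈ Icc s τ, f y v t = f' y v t)
    (hℓℓ' : ∀ y v, ∀ t ∈ Icc s τ, ℓ y v t = ℓ' y v t) :
    condValue f ℓ x s z τ = condValue f' ℓ' x s z τ := by
  refine iInf_congr fun ξ => iInf_congr fun u => ?_
  rw [runningCost_congr hsτ hℓℓ']
  exact iInf_congr_Prop ⟨fun h => h.congr_dynamics hff',
    fun h => h.congr_dynamics fun y v t ht => (hff' y v t ht).symm⟩ fun _ => rfl

end Admissible

/-! ### The two halves of the Hamilton–Jacobi–Bellman equation -/

section HamiltonJacobiBellman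

variable {n m : ℕ}
  {f : EuclideanSpace ℝ (Fin n) → EuclideanSpace ℝ (Fin m) → ℝ → EuclideanSpace ℝ (Fin n)}
  {ℓ : EuclideanSpace ℝ (Fin n) → EuclideanSpace ℝ (Fin m) → ℝ → ℝ}
  {x z : EuclideanSpace ℝ (Fin n)} {s τ t_f : ℝ} {L : EuclideanSpace ℝ (Fin n) × ℝ →L[ℝ] ℝ}

/-- No control value undercuts the `τ`-derivative: reach `z` at time `τ` along a trajectory of the
constant control `v`, and compare `V(z, τ)` with the value at an earlier point of it. Looking
backward from `τ` also covers the case `τ = t_f`. -/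
theorem fderiv_condValue_apply_le
    (hf : Continuous fun q : EuclideanSpace ℝ (Fin n) × EuclideanSpace ℝ (Fin m) × ℝ =>
      f q.1 q.2.1 q.2.2)
    (hℓ : Continuous fun q : EuclideanSpace ℝ (Fin n) × EuclideanSpace ℝ (Fin m) × ℝ =>
      ℓ q.1 q.2.1 q.2.2)
    (hsτ : s < τ) (hτ : τ ≤ t_f)
    (hfin : ∀ᶠ q : EuclideanSpace ℝ (Fin n) × ℝ in 𝓝[univ ×ˢ Icc s t_f] (z, τ),
      condValue f ℓ x s q.1 q.2 ≠ ⊤ ∧ condValue f ℓ x s q.1 q.2 ≠ ⊥)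
    (hL : HasFDerivWithinAt
      (fun q : EuclideanSpace ℝ (Fin n) × ℝ => (condValue f ℓ x s q.1 q.2).toReal) L
      (univ ×ˢ Icc s t_f) (z, τ)) (v : EuclideanSpace ℝ (Fin m)) :
    L (f z v τ, 1) ≤ ℓ z v τ := by
  obtain ⟨η, hη, hητ, a, haτ, hsol⟩ := exists_backward_solution
    (F := fun y t => f y v t)
    (hf.comp (continuous_fst.prodMk (continuous_const.prodMk continuous_snd))) z τ
  have hpath : Continuous fun t => (η t, v, t) :=
    hη.prodMk (continuous_const.prodMk continuous_id)
  have hfc : Continuous fun t => f (η t) v t := hf.comp hpath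
  have hℓc : Continuous fun t => ℓ (η t) v t := hℓ.comp hpath
  have hs : τ ∈ Icc s τ := right_mem_Icc.2 hsτ.le
  have hnear : ∀ᶠ t in 𝓝[Icc s τ] τ, t ∈ Icc s τ ∧ t ∈ Ioc a τ := by
    filter_upwards [self_mem_nhdsWithin, nhdsWithin_le_nhds (eventually_gt_nhds haτ)]
      with t ht hat using ⟨ht, hat, ht.2⟩
  have hderivη : HasDerivWithinAt η (f z v τ) (Icc s τ) τ := by
    have hd := (intervalIntegral.integral_hasDerivAt_left (hfc.intervalIntegrable τ τ)
      (hfc.stronglyMeasurableAtFilter _ _) hfc.continuousAt).const_sub z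
    rw [neg_neg, hητ] at hd
    exact hd.hasDerivWithinAt.congr_of_eventuallyEq
      (hnear.mono fun t ht => hsol t ht.2) (by simpa using hητ)
  have hmaps : MapsTo (fun t => (η t, t)) (Icc s τ)
      ((univ : Set (EuclideanSpace ℝ (Fin n))) ×ˢ Icc s t_f) :=
    fun t ht => ⟨mem_univ _, ht.1, ht.2.trans hτ⟩
  have hcurve := hderivη.prodMk (hasDerivWithinAt_id τ (Icc s τ))
  have hV : HasDerivWithinAt (fun t => (condValue f ℓ x s (η t) t).toReal) (L (f z v τ, 1))
      (Icc s τ) τ :=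
    hL.comp_hasDerivWithinAt_of_eq τ hcurve hmaps (by simp [hητ])
  have hcost : HasDerivAt (fun t => ∫ r in t..τ, ℓ (η r) v r) (-ℓ z v τ) τ := by
    have hd := intervalIntegral.integral_hasDerivAt_left (hℓc.intervalIntegrable τ τ)
      (hℓc.stronglyMeasurableAtFilter _ _) hℓc.continuousAt
    rwa [hητ] at hd
  have hmin : IsLocalMinOn
      (fun t => (condValue f ℓ x s (η t) t).toReal + ∫ r in t..τ, ℓ (η r) v r) (Icc s τ) τ := by
    have hfinη : ∀ᶠ t in 𝓝[Icc s τ] τ,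
        condValue f ℓ x s (η t) t ≠ ⊤ ∧ condValue f ℓ x s (η t) t ≠ ⊥ := by
      have := hcurve.continuousWithinAt.tendsto_nhdsWithin hmaps
      simp only [hητ, id] at this
      exact this.eventually hfin
    have hz := hfinη.self_of_nhdsWithin hs
    filter_upwards [hnear, hfinη] with t ht hft
    have hadm : IsAdmissible f (η t) t z τ η fun _ => v :=
      { le := ht.2.2
        memLp := memLp_top_const v
        continuousOn := hη.continuousOn
        dynamics := fun q hq => by
          rw [hsol q ⟨ht.2.1.trans_le hq.1, hq.2⟩, hsol t ht.2,
            ← intervalIntegral.integral_add_adjacent_intervals (hfc.intervalIntegrable t q)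
              (hfc.intervalIntegrable q τ)]
          abel
        start := rfl
        finish := hητ }
    have := condValue_toReal_le_add hf hℓ (by simpa only [hητ] using hz.2) hft.1 hadm
    simpa [hητ, runningCost] using this
  have hcone : s - τ ∈ posTangentConeAt (Icc s τ) τ :=
    sub_mem_posTangentConeAt_of_segment_subset
      ((convex_Icc s τ).segment_subset hs (left_mem_Icc.2 hsτ.le))
  have hnn := hmin.hasFDerivWithinAt_nonneg (hV.add hcost.hasDerivWithinAt).hasFDerivWithinAt hcone
  simp only [ContinuousLinearMap.toSpanSingleton_apply, smul_eq_mul] at hnn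
  nlinarith

/-- Converse to `fderiv_condValue_apply_le` for one control value. An optimal control stays in a
compact ball, on which `w ↦ ℓ(z, w, τ) - L(f(z, w, τ), 1)` has a minimizer `v`. Were the inequality
to fail at `v`, the integral of `ℓ - L(f, 1)` along the optimal pair over a short `[t, τ]` would be
at least a positive multiple of `τ - t`, whereas differentiability of the value function makes it
`o(τ - t)` at most. -/
theorem exists_le_fderiv_condValue_apply
    (hf : Continuous fun q : EuclideanSpace ℝ (Fin n) × EuclideanSpace ℝ (Fin m) × ℝ =>
      f q.1 q.2.1 q.2.2)
    (hℓ : Continuous fun q : EuclideanSpace ℝ (Fin n) × EuclideanSpace ℝ (Fin m) × ℝ =>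
      ℓ q.1 q.2.1 q.2.2)
    (hsτ : s < τ) (hτ : τ ≤ t_f) (hopt : ∃ ξ u, IsOptimal f ℓ x s z τ ξ u)
    (hfin : ∀ᶠ q : EuclideanSpace ℝ (Fin n) × ℝ in 𝓝[univ ×ˢ Icc s t_f] (z, τ),
      condValue f ℓ x s q.1 q.2 ≠ ⊤ ∧ condValue f ℓ x s q.1 q.2 ≠ ⊥)
    (hL : HasFDerivWithinAt
      (fun q : EuclideanSpace ℝ (Fin n) × ℝ => (condValue f ℓ x s q.1 q.2).toReal) L
      (univ ×ˢ Icc s t_f) (z, τ)) :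
    ∃ v, ℓ z v τ ≤ L (f z v τ, 1) := by
  obtain ⟨ξ, u, hadm, hval⟩ := hopt
  have hs : s ∈ Icc s τ := left_mem_Icc.2 hsτ.le
  have ht : τ ∈ Icc s τ := right_mem_Icc.2 hsτ.le
  obtain ⟨R, hR0, hR⟩ := hadm.exists_control_bound
  let G (y : EuclideanSpace ℝ (Fin n)) (w : EuclideanSpace ℝ (Fin m)) (t : ℝ) : ℝ :=
    ℓ y w t - L (f y w t, 1)
  have hG : Continuous fun q : EuclideanSpace ℝ (Fin n) × EuclideanSpace ℝ (Fin m) × ℝ =>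
      G q.1 q.2.1 q.2.2 := hℓ.sub (L.continuous.comp (hf.prodMk continuous_const))
  obtain ⟨v, -, hv⟩ := (isCompact_closedBall (0 : EuclideanSpace ℝ (Fin m)) R).exists_isMinOn
    ⟨0, Metric.mem_closedBall_self hR0⟩
    (hG.comp (continuous_const.prodMk (continuous_id.prodMk continuous_const)) :
      Continuous fun w => G z w τ).continuousOn
  refine ⟨v, not_lt.1 fun hlt => ?_⟩
  set ε := G z v τ with hε
  have hε0 : 0 < ε := sub_pos.2 hlt
  -- near `(z, τ)` the integrand stays above `ε / 2`, uniformly over the ball of control values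
  have hunif : ∀ᶠ p : EuclideanSpace ℝ (Fin n) × ℝ in 𝓝 (z, τ),
      ∀ w ∈ Metric.closedBall (0 : EuclideanSpace ℝ (Fin m)) R, ε / 2 < G p.1 w p.2 := by
    refine (isCompact_closedBall _ _).eventually_forall_of_forall_eventually fun w hw => ?_
    have hc : Continuous fun q : (EuclideanSpace ℝ (Fin n) × ℝ) × EuclideanSpace ℝ (Fin m) =>
        G q.1.1 q.2 q.1.2 :=
      hG.comp ((continuous_fst.comp continuous_fst).prodMk
        (continuous_snd.prodMk (continuous_snd.comp continuous_fst)))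
    exact hc.continuousAt.eventually_const_lt ((half_lt_self hε0).trans_le (hv hw))
  -- the optimal trajectory is Lipschitz at `τ`
  obtain ⟨C, hC⟩ := hadm.exists_bound hf
  have hLip {t : ℝ} (hts : t ∈ Icc s τ) : ‖ξ t - z‖ ≤ |C| * (τ - t) := by
    rw [← hadm.finish, hadm.sub_eq_integral hf ht hts, intervalIntegral.integral_symm, norm_neg]
    refine (intervalIntegral.norm_integral_le_of_norm_le_const_ae (C := |C|) ?_).trans_eq
      (by rw [abs_of_nonneg (sub_nonneg.2 hts.2)])
    filter_upwards [(ae_restrict_iff' measurableSet_Icc).1 hC] with q hq hqt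
    rw [uIoc_of_le hts.2] at hqt
    exact (hq ⟨hts.1.trans hqt.1.le, hqt.2⟩).trans (le_abs_self C)
  have hcurve : Tendsto (fun t => (ξ t, t)) (𝓝[Icc s τ] τ) (𝓝[univ ×ˢ Icc s t_f] (z, τ)) := by
    have := ((hadm.continuousOn τ ht).prodMk continuousWithinAt_id).tendsto_nhdsWithin
      (t := (univ : Set (EuclideanSpace ℝ (Fin n))) ×ˢ Icc s t_f)
      fun t ht => ⟨mem_univ _, ht.1, ht.2.trans hτ⟩
    simpa only [hadm.finish, id] using this
  have hc0 : 0 < ε / (4 * (|C| + 1)) := by positivity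
  have hsmall := hcurve.eventually (hL.isLittleO.def hc0)
  have hall := ((hsmall.and (hcurve.eventually hfin)).and
    ((hcurve.mono_right nhdsWithin_le_nhds).eventually hunif)).and self_mem_nhdsWithin
  rw [nhdsWithin_Icc_eq_nhdsLE hsτ] at hall
  obtain ⟨a, haτ, ha⟩ := mem_nhdsLE_iff_exists_Ioc_subset.1 hall
  have haτ : a < τ := haτ
  set t := (a + τ) / 2 with htdef
  have hat : a < t := by linarith
  have htτ : t < τ := by linarith
  obtain ⟨⟨⟨hsm, hft⟩, -⟩, hts⟩ := ha ⟨hat, htτ.le⟩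
  have hts : t ∈ Icc s τ := hts
  have hIf := hadm.intervalIntegrable hf hts ht
  have hIℓ := hadm.intervalIntegrable hℓ hts ht
  have hIG := hadm.intervalIntegrable hG hts ht
  have hlower : ε / 2 * (τ - t) ≤ ∫ q in t..τ, G (ξ q) (u q) q := by
    have := intervalIntegral.integral_mono_ae_restrict htτ.le
      (intervalIntegrable_const (c := ε / 2)) hIG (μ := volume) ?_
    · rwa [intervalIntegral.integral_const, smul_eq_mul, mul_comm] at this
    · filter_upwards [ae_restrict_of_ae_restrict_of_subset (Icc_subset_Icc_left hts.1) hR,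
        ae_restrict_mem measurableSet_Icc] with q hq hqt
      exact ((ha ⟨hat.trans_le hqt.1, hqt.2⟩).1.2 _ (mem_closedBall_zero_iff.2 hq)).le
  -- the cost after time `t` is at most the drop of the value along the optimal trajectory
  have hcost : (condValue f ℓ x s (ξ t) t).toReal + ∫ q in t..τ, ℓ (ξ q) (u q) q ≤
      (condValue f ℓ x s z τ).toReal := by
    have h1 := (hadm.restrict hts).condValue_le (ℓ := ℓ)
    rw [← EReal.coe_toReal hft.1 hft.2, EReal.coe_le_coe_iff] at h1
    have h2 : runningCost ℓ s τ ξ u = runningCost ℓ s t ξ u + ∫ q in t..τ, ℓ (ξ q) (u q) q :=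
      (intervalIntegral.integral_add_adjacent_intervals
        (hadm.intervalIntegrable hℓ hs hts) hIℓ).symm
    rw [← hval, EReal.toReal_coe, h2]
    linarith
  have hlin : L (ξ t - z, t - τ) = -∫ q in t..τ, L (f (ξ q) (u q) q, 1) := by
    have hIpair : IntervalIntegrable (fun q => (f (ξ q) (u q) q, (1 : ℝ))) volume t τ :=
      hadm.intervalIntegrable (g := fun y w q => (f y w q, (1 : ℝ)))
        (hf.prodMk continuous_const) hts ht
    have hpair : (ξ t - z, t - τ) = -∫ q in t..τ, (f (ξ q) (u q) q, (1 : ℝ)) := by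
      refine Prod.ext ?_ ?_
      · have h1 := (ContinuousLinearMap.fst ℝ (EuclideanSpace ℝ (Fin n))
          ℝ).intervalIntegral_comp_comm hIpair
        simp only [ContinuousLinearMap.coe_fst'] at h1
        rw [Prod.fst_neg, ← h1, ← hadm.sub_eq_integral hf hts ht, hadm.finish, neg_sub]
      · have h2 := (ContinuousLinearMap.snd ℝ (EuclideanSpace ℝ (Fin n))
          ℝ).intervalIntegral_comp_comm hIpair
        simp only [ContinuousLinearMap.coe_snd'] at h2
        rw [Prod.snd_neg, ← h2]
        simp
    rw [hpair, map_neg, L.intervalIntegral_comp_comm hIpair]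
  have hGint : ∫ q in t..τ, G (ξ q) (u q) q =
      (∫ q in t..τ, ℓ (ξ q) (u q) q) - ∫ q in t..τ, L (f (ξ q) (u q) q, 1) :=
    intervalIntegral.integral_sub hIℓ (hadm.intervalIntegrable
      (g := fun y w q => L (f y w q, (1 : ℝ)))
      (L.continuous.comp (hf.prodMk continuous_const)) hts ht)
  have hnorm : ‖(ξ t, t) - (z, τ)‖ ≤ (|C| + 1) * (τ - t) := by
    have h0 : 0 ≤ τ - t := sub_nonneg.2 hts.2
    rw [Prod.mk_sub_mk, Prod.norm_mk, Real.norm_eq_abs, abs_sub_comm, abs_of_nonneg h0]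
    refine max_le ((hLip hts).trans ?_) ?_ <;> nlinarith [abs_nonneg C]
  have herr : ε / (4 * (|C| + 1)) * ‖(ξ t, t) - (z, τ)‖ ≤ ε / 4 * (τ - t) := by
    refine (mul_le_mul_of_nonneg_left hnorm hc0.le).trans_eq ?_
    field_simp
  have habs := (abs_le.1 (hsm.trans herr)).1
  simp only [Prod.mk_sub_mk] at habs
  rw [hlin] at habs
  have := mul_pos hε0 (sub_pos.2 htτ)
  linarith

end HamiltonJacobiBellman

/-! ### The equation in terms of the gradient and the time derivative -/

theorem mainTheorem6 {n m : ℕ} (t₀ t_f : ℝ)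
    (f : EuclideanSpace ℝ (Fin n) → EuclideanSpace ℝ (Fin m) → ℝ → EuclideanSpace ℝ (Fin n))
    (ℓ : EuclideanSpace ℝ (Fin n) → EuclideanSpace ℝ (Fin m) → ℝ → ℝ)
    (hf : ContinuousOn
      (fun q : EuclideanSpace ℝ (Fin n) × EuclideanSpace ℝ (Fin m) × ℝ => f q.1 q.2.1 q.2.2)
      (univ ×ˢ univ ×ˢ Icc t₀ t_f))
    (hℓ : ContinuousOn
      (fun q : EuclideanSpace ℝ (Fin n) × EuclideanSpace ℝ (Fin m) × ℝ => ℓ q.1 q.2.1 q.2.2)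
      (univ ×ˢ univ ×ˢ Icc t₀ t_f))
    (x z : EuclideanSpace ℝ (Fin n)) (s τ : ℝ) (hs : t₀ ≤ s) (hsτ : s < τ) (hτ : τ ≤ t_f)
    -- the minimum that defines `V(x, s; z, τ)` is attained
    (hopt : ∃ ξ u, IsOptimal f ℓ x s z τ ξ u)
    -- `V(x, s; ·, ·)` is finite near `(z, τ)` and differentiable there
    (hfin : ∀ᶠ q : EuclideanSpace ℝ (Fin n) × ℝ in 𝓝[univ ×ˢ Icc s t_f] (z, τ),
      condValue f ℓ x s q.1 q.2 ≠ ⊤ ∧ condValue f ℓ x s q.1 q.2 ≠ ⊥)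
    (hdiff : DifferentiableWithinAt ℝ
      (fun q : EuclideanSpace ℝ (Fin n) × ℝ => (condValue f ℓ x s q.1 q.2).toReal)
      (univ ×ˢ Icc s t_f) (z, τ)) :
    IsLeast
      (range fun u : EuclideanSpace ℝ (Fin m) =>
        ℓ z u τ - inner ℝ (gradient (fun w => (condValue f ℓ x s w τ).toReal) z) (f z u τ))
      (derivWithin (fun r => (condValue f ℓ x s z r).toReal) (Icc s t_f) τ) := by
  have hst : s < t_f := hsτ.trans_le hτ
  have htf : t₀ ≤ t_f := hs.trans hst.le
  have hτmem : τ ∈ Icc s t_f := ⟨hsτ.le, hτ⟩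
  -- Freezing `f` and `ℓ` outside `[t₀, t_f]` makes them continuous everywhere and leaves the
  -- value function unchanged on the times considered.
  let f' (y : EuclideanSpace ℝ (Fin n)) (v : EuclideanSpace ℝ (Fin m)) (t : ℝ) :
      EuclideanSpace ℝ (Fin n) := f y v (projIcc t₀ t_f htf t)
  let ℓ' (y : EuclideanSpace ℝ (Fin n)) (v : EuclideanSpace ℝ (Fin m)) (t : ℝ) : ℝ :=
    ℓ y v (projIcc t₀ t_f htf t)
  have hproj : Continuous fun q : EuclideanSpace ℝ (Fin n) × EuclideanSpace ℝ (Fin m) × ℝ =>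
      (q.1, q.2.1, (projIcc t₀ t_f htf q.2.2 : ℝ)) :=
    continuous_fst.prodMk ((continuous_fst.comp continuous_snd).prodMk
      (continuous_subtype_val.comp (continuous_projIcc.comp
        (continuous_snd.comp continuous_snd))))
  have hprojmem (q : EuclideanSpace ℝ (Fin n) × EuclideanSpace ℝ (Fin m) × ℝ) :
      (q.1, q.2.1, (projIcc t₀ t_f htf q.2.2 : ℝ)) ∈
        (univ : Set (EuclideanSpace ℝ (Fin n))) ×ˢ
          (univ : Set (EuclideanSpace ℝ (Fin m))) ×ˢ Icc t₀ t_f :=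
    ⟨mem_univ _, mem_univ _, Subtype.coe_prop _⟩
  have hf' : Continuous fun q : EuclideanSpace ℝ (Fin n) × EuclideanSpace ℝ (Fin m) × ℝ =>
      f' q.1 q.2.1 q.2.2 := hf.comp_continuous hproj hprojmem
  have hℓ' : Continuous fun q : EuclideanSpace ℝ (Fin n) × EuclideanSpace ℝ (Fin m) × ℝ =>
      ℓ' q.1 q.2.1 q.2.2 := hℓ.comp_continuous hproj hprojmem
  have hff' {r : ℝ} (hr : r ≤ t_f) (y v) (t) (ht : t ∈ Icc s r) : f y v t = f' y v t := by
    simp only [f', projIcc_of_mem htf ⟨hs.trans ht.1, ht.2.trans hr⟩]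
  have hℓℓ' {r : ℝ} (hr : r ≤ t_f) (y v) (t) (ht : t ∈ Icc s r) : ℓ y v t = ℓ' y v t := by
    simp only [ℓ', projIcc_of_mem htf ⟨hs.trans ht.1, ht.2.trans hr⟩]
  have hV (y : EuclideanSpace ℝ (Fin n)) {r : ℝ} (hr : r ∈ Icc s t_f) :
      condValue f ℓ x s y r = condValue f' ℓ' x s y r :=
    condValue_congr hr.1 (hff' hr.2) (hℓℓ' hr.2)
  have hopt' : ∃ ξ u, IsOptimal f' ℓ' x s z τ ξ u := by
    obtain ⟨ξ, u, h, hval⟩ := hopt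
    refine ⟨ξ, u, h.congr_dynamics (hff' hτ), ?_⟩
    rw [← hV z hτmem, ← hval, runningCost_congr hsτ.le (hℓℓ' hτ)]
  have hfin' : ∀ᶠ q : EuclideanSpace ℝ (Fin n) × ℝ in 𝓝[univ ×ˢ Icc s t_f] (z, τ),
      condValue f' ℓ' x s q.1 q.2 ≠ ⊤ ∧ condValue f' ℓ' x s q.1 q.2 ≠ ⊥ := by
    filter_upwards [hfin, self_mem_nhdsWithin] with q hq hqm
    rwa [← hV q.1 hqm.2]
  obtain ⟨L, hL⟩ := hdiff
  have hL' : HasFDerivWithinAt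
      (fun q : EuclideanSpace ℝ (Fin n) × ℝ => (condValue f' ℓ' x s q.1 q.2).toReal) L
      (univ ×ˢ Icc s t_f) (z, τ) :=
    hL.congr (fun q hq => by simp only [hV q.1 hq.2]) (by simp only [hV z hτmem])
  have htime : derivWithin (fun r => (condValue f ℓ x s z r).toReal) (Icc s t_f) τ = L (0, 1) :=
    (hL.comp_hasDerivWithinAt τ
      ((hasDerivWithinAt_const τ (Icc s t_f) z).prodMk (hasDerivWithinAt_id τ (Icc s t_f)))
      fun t ht => ⟨mem_univ _, ht⟩).derivWithin (uniqueDiffOn_Icc hst τ hτmem)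
  have hspace (w : EuclideanSpace ℝ (Fin n)) :
      inner ℝ (gradient (fun w => (condValue f ℓ x s w τ).toReal) z) w = L (w, 0) := by
    have hslice : HasFDerivWithinAt (fun w : EuclideanSpace ℝ (Fin n) => (w, τ))
        ((ContinuousLinearMap.id ℝ (EuclideanSpace ℝ (Fin n))).prod 0) univ z :=
      (hasFDerivWithinAt_id z univ).prodMk (hasFDerivWithinAt_const τ z univ)
    have hd : HasFDerivWithinAt (fun w => (condValue f ℓ x s w τ).toReal)
        (L.comp ((ContinuousLinearMap.id ℝ (EuclideanSpace ℝ (Fin n))).prod 0)) univ z :=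
      HasFDerivWithinAt.comp (g := fun q : EuclideanSpace ℝ (Fin n) × ℝ =>
        (condValue f ℓ x s q.1 q.2).toReal) z hL hslice fun w _ => mk_mem_prod (mem_univ w) hτmem
    rw [← InnerProductSpace.toDual_apply_apply, toDual_gradient,
      (hasFDerivWithinAt_univ.1 hd).fderiv]
    simp
  have hsplit (w : EuclideanSpace ℝ (Fin n)) : L (w, 1) = L (w, 0) + L (0, 1) := by
    rw [← map_add, Prod.mk_add_mk, add_zero, zero_add]
  have hfτ (v) : f z v τ = f' z v τ := hff' hτ z v τ ⟨hsτ.le, le_rfl⟩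
  have hℓτ (v) : ℓ z v τ = ℓ' z v τ := hℓℓ' hτ z v τ ⟨hsτ.le, le_rfl⟩
  have hge (v) : L (0, 1) ≤ ℓ z v τ - L (f z v τ, 0) := by
    have := fderiv_condValue_apply_le hf' hℓ' hsτ hτ hfin' hL' v
    rw [hsplit, ← hfτ, ← hℓτ] at this
    linarith
  obtain ⟨v, hv⟩ := exists_le_fderiv_condValue_apply hf' hℓ' hsτ hτ hopt' hfin' hL'
  rw [hsplit, ← hfτ, ← hℓτ] at hv
  simp only [htime, hspace]
  refine ⟨⟨v, le_antisymm ?_ (hge v)⟩, ?_⟩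
  · linarith
  · rintro _ ⟨w, rfl⟩
    exact hge w
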